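/- **Setting.** $N\ge1$ agents play a $K$-armed bandit ($K\ge 1$) for $T\ge NK$ rounds. Arm $k$ has a reward distribution $\mathcal D_k$ supported on $[0,1]^d$ ($d\ge1$) with mean vector $\mu_k$. In round $t$, agent $n$ chooses an arm $k_{n,t}$ and whether to verify, $V_{n,t}\in\{0,1\}$ (at most $\nu$ verifications in total), on the basis of the past; given the past and the joint action, the clean rewards $R_{n,t}\sim\mathcal D_{k_{n,t}}$ are independent across agents. An adversary that may depend on the past and on the current actions chooses corruptions $C_{n,t}\in\mathbb R^d$, with $C_{n,t}=0$ if $V_{n,t}=1$ and $\sum_{t,n}\|C_{n,t}\|_\infty\le\Gamma$. The observation is $X_{n,t}=R_{n,t}$ if $V_{n,t}=1$ and $X_{n,t}=\Pi_{[0,1]^d}(R_{n,t}+C_{n,t})$ otherwise, where $\Pi_{[0,1]^d}$ is coordinate-wise projection. Let $\phi:[0,1]^d\to\mathbb R$ be coordinate-wise nondecreasing and $L$-Lipschitz for $\|\cdot\|_\infty$, let $k^*\in\arg\max_k\phi(\mu_k)$, and let $$\mathrm{Reg}^{\mathrm{team}}_\phi(T)=\sum_{t=1}^T\sum_{n=1}^N\big(\phi(\mu_{k^*})-\phi(\mu_{k_{n,t}})\big).$$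 **Raw-sample append-all sharing (S1).** After each round every agent $n$ broadcasts $(k_{n,t},X_{n,t},V_{n,t})$, and every agent $j$ appends all $N$ broadcasts (its own included) to a local multiset. Let $\mathcal I_{j,k}(t)$ be the multiset of labels $(n,\tau)$ of the samples of arm $k$ held by agent $j$ at the end of round $t$, and $\widehat\mu_{j,k}(t)=\frac1{\max\{1,|\mathcal I_{j,k}(t)|\}}\sum_{(n,\tau)\in\mathcal I_{j,k}(t)}X_{n,\tau}$. Put $\rho_{n,t}=\#\{j:(n,t)\in\mathcal I_{j,k_{n,t}}(T)\}$, $$\Gamma_{\mathrm{eff}}=\sum_{t,n}\rho_{n,t}\|C_{n,t}\|_\infty,\qquad \Gamma_{\mathrm{eff},k}=\sum_{t,n}\rho_{n,t}\|C_{n,t}\|_\infty\mathbf 1\{k_{n,t}=k\}.$$ Fix $\delta\in(0,1)$ and suppose that in every round $t$ each agent $j$ pulls an arm $k$ maximizing $\phi\big(\Pi_{[0,1]^d}(\widehat\mu_{j,k}(t-1)+\beta_{j,k}(t-1)\mathbf 1)\big)$ (ties broken arbitrarily), where $$\beta_{j,k}(t)=\sqrt{\frac{\log(2dKNT/\delta)}{2\max\{1,|\mathcal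 I_{j,k}(t)|\}}}+\frac{\Gamma_{\mathrm{eff},k}}{\max\{1,|\mathcal I_{j,k}(t)|\}}.$$ **Claim.** Always $\rho_{n,t}=N$ for all $n,t$, and $\Gamma_{\mathrm{eff}}=N\sum_{t,n}\|C_{n,t}\|_\infty\le N\Gamma$, so that $\Gamma_{\mathrm{eff}}=N\Gamma$ when the adversary spends its whole budget. Moreover, with probability at least $1-\delta$, $$\mathrm{Reg}^{\mathrm{team}}_\phi(T)\le c\,L\Big(\sqrt{KNT\log(2dKNT/\delta)}+N\Gamma\log(1+NT)\Big)$$ for a universal constant $c>0$; that is, $\mathrm{Reg}^{\mathrm{team}}_\phi(T)\le\widetilde O\big(L\sqrt{KNT}+LN\Gamma\big)$. -/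

import Mathlib

open MeasureTheory

noncomputable section

namespace CoopBandit

/-- Coordinate-wise projection onto the cube `[0,1]^d`. (`Fin d → ℝ` carries the sup norm.) -/
def clip {d : ℕ} (x : Fin d → ℝ) : Fin d → ℝ := fun i => max 0 (min 1 (x i))

/-- The mean vector of a reward distribution on `ℝ^d`. -/
def meanVec {d : ℕ} (D : Measure (Fin d → ℝ)) : Fin d → ℝ := fun i => ∫ x, x i ∂D

/-- The scalarizations considered: coordinate-wise nondecreasing on `[0,1]^d`, and `L`-Lipschitz
there with respect to the sup norm. -/
structure IsScalarization {d : ℕ} (L : ℝ) (φ : (Fin d → ℝ) → ℝ) : Prop where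
  mono : ∀ x ∈ Set.Icc (0 : Fin d → ℝ) 1, ∀ y ∈ Set.Icc (0 : Fin d → ℝ) 1, x ≤ y → φ x ≤ φ y
  lip : ∀ x ∈ Set.Icc (0 : Fin d → ℝ) 1, ∀ y ∈ Set.Icc (0 : Fin d → ℝ) 1,
    |φ x - φ y| ≤ L * ‖x - y‖

/-- A run over rounds `1, …, T` of `N` agents on a `K`-armed bandit with reward distributions `D`,
verification budget `ν` and corruption budget `Γ`. -/
structure Run (N K d T ν : ℕ) (Γ : ℝ) (D : Fin K → Measure (Fin d → ℝ))
    {Ω : Type*} [mΩ : MeasurableSpace Ω] (P : Measure Ω) where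
  /-- `hist t` is everything that is determined when round `t` has ended, before the rewards of
  round `t + 1` are drawn: it contains every agent's observations and received messages, the
  adversary's choices, and any side information or private randomization. -/
  hist : Filtration ℕ mΩ
  /-- `arm n t` is the arm that agent `n` pulls in round `t`. -/
  arm : Fin N → ℕ → Ω → Fin K
  /-- `ver n t` says whether agent `n` verifies in round `t`. -/
  ver : Fin N → ℕ → Ω → Bool
  /-- `reward n t` is the clean reward vector. -/
  reward : Fin N → ℕ → Ω → (Fin d → ℝ)
  /-- `corr n t` is the corruption vector. -/
  corr : Fin N → ℕ → Ω → (Fin d → ℝ)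
  arm_meas : ∀ n, ∀ t ∈ Finset.Icc 1 T, Measurable[hist (t - 1)] (arm n t)
  ver_meas : ∀ n, ∀ t ∈ Finset.Icc 1 T, Measurable[hist (t - 1)] (ver n t)
  corr_meas : ∀ n, ∀ t ∈ Finset.Icc 1 T, Measurable[hist (t - 1)] (corr n t)
  reward_meas : ∀ n, ∀ t ∈ Finset.Icc 1 T, Measurable[hist t] (reward n t)
  /-- Given the past and the joint action `a`, the rewards of round `t` are independent across
  agents, the one of agent `n` having law `D (a n)`. -/
  reward_law : ∀ t ∈ Finset.Icc 1 T, ∀ (a : Fin N → Fin K) (A : Set Ω),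
    MeasurableSet[hist (t - 1)] A → (∀ ω ∈ A, ∀ n, arm n t ω = a n) →
      (P.restrict A).map (fun ω n => reward n t ω) = P A • Measure.pi (fun n => D (a n))
  /-- At most `ν` verifications. -/
  ver_budget : ∀ ω, ∑ t ∈ Finset.Icc 1 T, ∑ n, (if ver n t ω then 1 else 0) ≤ ν
  /-- Verified observations are not corrupted. -/
  corr_ver : ∀ n, ∀ t ∈ Finset.Icc 1 T, ∀ ω, ver n t ω = true → corr n t ω = 0
  /-- The global corruption budget. -/
  corr_budget : ∀ ω, ∑ t ∈ Finset.Icc 1 T, ∑ n, ‖corr n t ω‖ ≤ Γ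

/-- The triple that an agent broadcasts under raw-sample sharing. -/
structure Message (K d : ℕ) where
  arm : Fin K
  obs : Fin d → ℝ
  ver : Bool

namespace Run

variable {N K d T ν : ℕ} {Γ : ℝ} {D : Fin K → Measure (Fin d → ℝ)}
  {Ω : Type*} [MeasurableSpace Ω] {P : Measure Ω} (r : Run N K d T ν Γ D P)

/-- The feedback that agent `n` observes and uses in round `t`. -/
def obs (n : Fin N) (t : ℕ) (ω : Ω) : Fin d → ℝ :=
  if r.ver n t ω then r.reward n t ω else clip (r.reward n t ω + r.corr n t ω)

/-- The total corruption spent by the adversary. -/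
def totalCorr (ω : Ω) : ℝ := ∑ t ∈ Finset.Icc 1 T, ∑ n, ‖r.corr n t ω‖

/-- The team regret with respect to the arm `kstar`. -/
def teamRegret (φ : (Fin d → ℝ) → ℝ) (kstar : Fin K) (ω : Ω) : ℝ :=
  ∑ t ∈ Finset.Icc 1 T, ∑ n, (φ (meanVec (D kstar)) - φ (meanVec (D (r.arm n t ω))))

/-! ### Raw-sample sharing with append-all -/

/-- The message broadcast by agent `p.1` at the end of round `p.2`. -/
def message (p : Fin N × ℕ) (ω : Ω) : Message K d :=
  ⟨r.arm p.1 p.2 ω, r.obs p.1 p.2 ω, r.ver p.1 p.2 ω⟩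

/-- The multiset of the labels `(n, τ)` of the messages that agent `j` has appended to its local
data by the end of round `t`: after each round, one copy of each agent's broadcast (its own one
included). -/
def received (N : ℕ) (_j : Fin N) : ℕ → Multiset (Fin N × ℕ)
  | 0 => 0
  | t + 1 => received N _j t + (Finset.univ : Finset (Fin N)).val.map (fun n => (n, t + 1))

/-- The local multiset of received triples of agent `j` at the end of round `t`. -/
def store (j : Fin N) (t : ℕ) (ω : Ω) : Multiset (Message K d) :=
  (received N j t).map (fun p => r.message p ω)

/-- `samples j k t ω` is the multiset of agent-round labels whose observations are included with
unit weight in the estimate of arm `k` by agent `j`'s local estimator at the end of round `t`. -/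
def samples (j : Fin N) (k : Fin K) (t : ℕ) (ω : Ω) : Multiset (Fin N × ℕ) :=
  (received N j t).filter (fun p => (r.message p ω).arm = k)

/-- Agent `j`'s local empirical mean vector of arm `k` at the end of round `t`: the average of the
stored observations of arm `k` (zero if there is none). -/
def estimate (j : Fin N) (k : Fin K) (t : ℕ) (ω : Ω) : Fin d → ℝ :=
  let data := (r.store j t ω).filter (fun m => m.arm = k)
  (max 1 (data.card : ℝ))⁻¹ • (data.map (fun m => m.obs)).sum

/-- The multiplicity of the agent-round `(n, t)`: the number of estimators that include its
observation. -/
def multiplicity (n : Fin N) (t : ℕ) (ω : Ω) : ℕ :=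
  (Finset.univ.filter (fun j : Fin N => (n, t) ∈ r.samples j (r.arm n t ω) T ω)).card

/-- The effective corruption. -/
def effCorr (ω : Ω) : ℝ :=
  ∑ t ∈ Finset.Icc 1 T, ∑ n, (r.multiplicity n t ω : ℝ) * ‖r.corr n t ω‖

/-- The effective corruption of arm `k`. -/
def effCorrArm (k : Fin K) (ω : Ω) : ℝ :=
  ∑ t ∈ Finset.Icc 1 T, ∑ n,
    (r.multiplicity n t ω : ℝ) * ‖r.corr n t ω‖ * (if r.arm n t ω = k then 1 else 0)

/-- The confidence radius of estimator `j` for arm `k` at the end of round `t`. -/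
def radius (δ : ℝ) (j : Fin N) (k : Fin K) (t : ℕ) (ω : Ω) : ℝ :=
  √(Real.log (2 * d * K * N * T / δ) / (2 * max 1 ((r.samples j k t ω).card : ℝ)))
    + r.effCorrArm k ω / max 1 ((r.samples j k t ω).card : ℝ)

/-- The optimistic index of arm `k` formed by estimator `j` at the end of round `t`. -/
def index (φ : (Fin d → ℝ) → ℝ) (δ : ℝ) (j : Fin N) (k : Fin K) (t : ℕ) (ω : Ω) : ℝ :=
  φ (clip (fun i => r.estimate j k t ω i + r.radius δ j k t ω))

/-- Every agent always pulls an arm of maximal index of its own local estimator, ties being broken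
arbitrarily. -/
def IsAppendAllUCB (φ : (Fin d → ℝ) → ℝ) (δ : ℝ) : Prop :=
  ∀ n, ∀ t ∈ Finset.Icc 1 T, ∀ ω k,
    r.index φ δ n k (t - 1) ω ≤ r.index φ δ n (r.arm n t ω) (t - 1) ω

end Run

end CoopBandit

end

/-! Since everyone appends everything, all agents hold the same samples: the estimate and the radius
of an arm do not depend on the agent, each sample has multiplicity `N`, and the team acts as one
learner whose data arrive in batches of at most `N` pulls per arm and round.

Concentration. For fixed `k`, coordinate and `m`, the exponentials of `s * (reward - mean) - s ^ 2 /
8`, accumulated while the count of arm `k` is at most `m`, have expectation at most 1. If the count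
ever equals `m`, the terminal value is the one at that time, so Markov's inequality at time `T`
covers all times (`measure_exists_cleanDev_gt_le`). A union bound over arm, coordinate, `m ≤ N * T`
and sign gives `2dKNT * exp (-l)`, which is `δ` for `l = log (2dKNT / δ)`. The selection rule plays
no role here; only predictability of the arms does.

Regret. On the good event optimism bounds the gap of a pulled arm by `2L` times its radius before
the round. The radius is stale within a batch, so batches are charged to a potential
(`batch_mul_le_potential_sub`): pulls starting from a count below `N` cost at most `L` each, fewer
than `2N` per arm; otherwise the batch at most doubles the count, and the square-root and harmonic
sums survive up to constants. Cauchy-Schwarz over the arms and the corruption budget finish. -/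

noncomputable section

namespace CoopBandit

/-! ### Pooled counts and multiplicities. -/

namespace Run

variable {N K d T ν : ℕ} {Γ : ℝ} {D : Fin K → Measure (Fin d → ℝ)}
  {Ω : Type*} [MeasurableSpace Ω] {P : Measure Ω} (r : Run N K d T ν Γ D P)

/-- The number of pulls of arm `k`, over all agents, in the rounds `1, …, t`. -/
def count (k : Fin K) (t : ℕ) (ω : Ω) : ℕ :=
  ∑ τ ∈ Finset.Icc 1 t, ∑ n, if r.arm n τ ω = k then 1 else 0

/-- The number of agents that pull arm `k` in round `t`. -/
def batch (k : Fin K) (t : ℕ) (ω : Ω) : ℕ := ∑ n, if r.arm n t ω = k then 1 else 0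

lemma count_zero (k : Fin K) (ω : Ω) : r.count k 0 ω = 0 := by simp [count]

lemma count_succ (k : Fin K) (t : ℕ) (ω : Ω) :
    r.count k (t + 1) ω = r.count k t ω + r.batch k (t + 1) ω := by
  simp [count, batch, Finset.sum_Icc_succ_top]

lemma batch_le (k : Fin K) (t : ℕ) (ω : Ω) : r.batch k t ω ≤ N := by
  calc r.batch k t ω ≤ ∑ _n : Fin N, 1 := by
        apply Finset.sum_le_sum; intro n _; split_ifs <;> simp
    _ = N := by simp

lemma count_mono (k : Fin K) (ω : Ω) : Monotone fun t => r.count k t ω :=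
  monotone_nat_of_le_succ fun t => by simp [count_succ]

lemma sum_batch (t : ℕ) (ω : Ω) : ∑ k, r.batch k t ω = N := by
  unfold batch
  rw [Finset.sum_comm]
  simp

lemma sum_count (t : ℕ) (ω : Ω) : ∑ k, r.count k t ω = N * t := by
  induction t with
  | zero => simp [count_zero]
  | succ t ih => simp only [count_succ, Finset.sum_add_distrib, ih, sum_batch]; ring

/-- The right-hand side is free of `j`; this is what makes counts and estimates common to all
agents. -/
lemma sum_map_filter_received {M : Type*} [AddCommMonoid M] (j : Fin N) (t : ℕ)
    (q : Fin N × ℕ → Prop) [DecidablePred q] (f : Fin N × ℕ → M) :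
    (((received N j t).filter q).map f).sum =
      ∑ τ ∈ Finset.Icc 1 t, ∑ n, if q (n, τ) then f (n, τ) else 0 := by
  induction t with
  | zero => simp [received]
  | succ t ih =>
    simp only [received, Multiset.filter_add, Multiset.map_add, Multiset.sum_add, ih]
    rw [Finset.sum_Icc_succ_top (by omega)]
    congr 1
    rw [Multiset.filter_map, Multiset.map_map]
    rw [← Finset.sum_filter]
    rfl

lemma mem_received (j : Fin N) (t : ℕ) (p : Fin N × ℕ) :
    p ∈ received N j t ↔ p.2 ∈ Finset.Icc 1 t := by
  induction t with
  | zero => simp [received]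
  | succ t ih =>
    simp only [received, Multiset.mem_add, ih, Multiset.mem_map, Finset.mem_val, Finset.mem_univ,
      true_and, Finset.mem_Icc, Prod.ext_iff, exists_eq_left]
    omega

lemma card_samples (j : Fin N) (k : Fin K) (t : ℕ) (ω : Ω) :
    (r.samples j k t ω).card = r.count k t ω := by
  have h := sum_map_filter_received j t (fun p => (r.message p ω).arm = k) (fun _ => 1)
  rw [Multiset.map_const', Multiset.sum_replicate, smul_eq_mul, mul_one] at h
  exact h

lemma estimate_apply (j : Fin N) (k : Fin K) (t : ℕ) (ω : Ω) (i : Fin d) :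
    r.estimate j k t ω i = (max 1 (r.count k t ω : ℝ))⁻¹ *
      ∑ τ ∈ Finset.Icc 1 t, ∑ n, if r.arm n τ ω = k then r.obs n τ ω i else 0 := by
  have h1 : ((r.store j t ω).filter (fun m => m.arm = k)) =
      (r.samples j k t ω).map (fun p => r.message p ω) := by
    rw [store, Multiset.filter_map]; rfl
  simp only [estimate, h1, Multiset.card_map, card_samples, Multiset.map_map]
  rw [samples, sum_map_filter_received]
  simp only [message, Pi.smul_apply, smul_eq_mul, Finset.sum_apply, Function.comp_apply]
  congr 1
  refine Finset.sum_congr rfl fun τ _ => Finset.sum_congr rfl fun n _ => ?_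
  by_cases h : r.arm n τ ω = k <;> simp [h]

lemma multiplicity_eq (n : Fin N) {t : ℕ} (ht : t ∈ Finset.Icc 1 T) (ω : Ω) :
    r.multiplicity n t ω = N := by
  have : ∀ j : Fin N, (n, t) ∈ r.samples j (r.arm n t ω) T ω := by
    intro j
    rw [samples, Multiset.mem_filter, mem_received]
    exact ⟨ht, rfl⟩
  simp [multiplicity, this]

/-- The corruption spent on arm `k`. -/
def armCorr (k : Fin K) (ω : Ω) : ℝ :=
  ∑ t ∈ Finset.Icc 1 T, ∑ n, if r.arm n t ω = k then ‖r.corr n t ω‖ else 0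

lemma armCorr_nonneg (k : Fin K) (ω : Ω) : 0 ≤ r.armCorr k ω :=
  Finset.sum_nonneg fun _ _ => Finset.sum_nonneg fun _ _ => by split_ifs <;> simp

lemma sum_armCorr (ω : Ω) : ∑ k, r.armCorr k ω = r.totalCorr ω := by
  unfold armCorr totalCorr
  rw [Finset.sum_comm]
  refine Finset.sum_congr rfl fun t _ => ?_
  rw [Finset.sum_comm]
  simp

lemma effCorr_eq (ω : Ω) : r.effCorr ω = N * r.totalCorr ω := by
  simp only [effCorr, totalCorr, Finset.mul_sum]
  refine Finset.sum_congr rfl fun t ht => Finset.sum_congr rfl fun n _ => ?_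
  rw [r.multiplicity_eq n ht]

lemma effCorrArm_eq (k : Fin K) (ω : Ω) : r.effCorrArm k ω = N * r.armCorr k ω := by
  simp only [effCorrArm, armCorr, Finset.mul_sum]
  refine Finset.sum_congr rfl fun t ht => Finset.sum_congr rfl fun n _ => ?_
  rw [r.multiplicity_eq n ht]
  split_ifs <;> simp

end Run

/-! ### The exponential supermartingale. -/

open ProbabilityTheory in
/-- Hoeffding's lemma for a coordinate of a distribution on the unit cube. -/
lemma lintegral_exp_coord_le_one {d : ℕ} (μ : Measure (Fin d → ℝ)) [IsProbabilityMeasure μ]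
    (hμ : μ (Set.Icc (0 : Fin d → ℝ) 1)ᶜ = 0) (i : Fin d) (s : ℝ) :
    ∫⁻ x, ENNReal.ofReal (Real.exp (s * (x i - meanVec μ i) - s ^ 2 / 8)) ∂μ ≤ 1 := by
  have hb : ∀ᵐ x ∂μ, x i ∈ Set.Icc (0 : ℝ) 1 := by
    have h : ∀ᵐ x ∂μ, x ∈ Set.Icc (0 : Fin d → ℝ) 1 := hμ
    filter_upwards [h] with x hx using ⟨hx.1 i, hx.2 i⟩
  have hsub := hasSubgaussianMGF_of_mem_Icc (μ := μ) (X := fun x : Fin d → ℝ => x i)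
    (measurable_pi_apply i).aemeasurable hb
  have hint := hsub.integrable_exp_mul s
  have hle := hsub.mgf_le s
  have he : ∀ x : Fin d → ℝ, Real.exp (s * (x i - meanVec μ i) - s ^ 2 / 8) =
      Real.exp (s * (x i - meanVec μ i)) * Real.exp (-(s ^ 2 / 8)) := fun x => by
    rw [← Real.exp_add, sub_eq_add_neg]
  rw [← ofReal_integral_eq_lintegral_ofReal]
  · rw [ENNReal.ofReal_le_one]
    simp_rw [he]
    rw [integral_mul_const]
    have h2 : (∫ x, Real.exp (s * (x i - meanVec μ i)) ∂μ) ≤ Real.exp (s ^ 2 / 8) := by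
      refine hle.trans (le_of_eq ?_)
      congr 1
      norm_num
      ring
    calc _ ≤ Real.exp (s ^ 2 / 8) * Real.exp (-(s ^ 2 / 8)) :=
          mul_le_mul_of_nonneg_right h2 (Real.exp_pos _).le
      _ = 1 := by rw [← Real.exp_add]; simp
  · simp_rw [he]
    exact hint.mul_const _
  · exact Filter.Eventually.of_forall fun _ => (Real.exp_pos _).le

/-- If `g` integrates to at most the measure over every event of a sub-σ-algebra, then multiplying
by `g` does not increase the integral of a function measurable for that σ-algebra. -/
lemma lintegral_mul_le_of_setLIntegral_le {Ω : Type*} {m mΩ : MeasurableSpace Ω} (hm : m ≤ mΩ)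
    {P : Measure Ω} {f g : Ω → ENNReal} (hf : Measurable[m] f) (hg : Measurable g)
    (h : ∀ A, MeasurableSet[m] A → ∫⁻ ω in A, g ω ∂P ≤ P A) :
    ∫⁻ ω, f ω * g ω ∂P ≤ ∫⁻ ω, f ω ∂P := by
  have h1 : ∫⁻ ω, f ω * g ω ∂P = ∫⁻ ω, f ω ∂(P.withDensity g) := by
    rw [lintegral_withDensity_eq_lintegral_mul _ hg (hf.mono hm le_rfl)]
    simp [mul_comm]
  -- The hypothesis says that `P.withDensity g`, trimmed to `m`, is dominated by the trimmed `P`.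
  -- This replaces a conditional expectation and needs no integrability.
  rw [h1, ← lintegral_trim hm hf, ← lintegral_trim hm hf]
  refine lintegral_mono' ?_ le_rfl
  refine Measure.le_iff.2 fun A hA => ?_
  rw [trim_measurableSet_eq hm hA, trim_measurableSet_eq hm hA, withDensity_apply _ (hm _ hA)]
  exact h A hA

namespace Run

variable {N K d T ν : ℕ} {Γ : ℝ} {D : Fin K → Measure (Fin d → ℝ)}
  {Ω : Type*} [MeasurableSpace Ω] {P : Measure Ω} (r : Run N K d T ν Γ D P)

lemma measurable_reward (n : Fin N) {t : ℕ} (ht : t ∈ Finset.Icc 1 T) :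
    Measurable (r.reward n t) :=
  (r.reward_meas n t ht).mono (r.hist.le t) le_rfl

lemma measurableSet_arm_eq (n : Fin N) (k : Fin K) {t : ℕ} (ht : t ∈ Finset.Icc 1 T) :
    MeasurableSet[r.hist (t - 1)] {ω | r.arm n t ω = k} :=
  r.arm_meas n t ht (measurableSet_singleton k)

/-- Predictability: the arms of round `t` are known at time `t - 1`, so the count including round
`t` is too. -/
lemma measurable_count (k : Fin K) {t : ℕ} (ht : t ∈ Finset.Icc 1 T) :
    Measurable[r.hist (t - 1)] (r.count k t) := by
  unfold count
  refine Finset.measurable_sum _ fun τ hτ => Finset.measurable_sum _ fun n _ => ?_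
  have hτ' := Finset.mem_Icc.1 hτ
  have ht' := Finset.mem_Icc.1 ht
  refine Measurable.ite ?_ measurable_const measurable_const
  exact r.hist.mono (by omega) _
    (r.measurableSet_arm_eq n k (Finset.mem_Icc.2 ⟨hτ'.1, hτ'.2.trans ht'.2⟩))

/-- The contribution of round `t` to the exponential supermartingale for coordinate `i` of the
rewards of arm `k`. -/
def incr (s : ℝ) (k : Fin K) (i : Fin d) (t : ℕ) (ω : Ω) : ℝ :=
  ∑ n, if r.arm n t ω = k then s * (r.reward n t ω i - meanVec (D k) i) - s ^ 2 / 8 else 0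

lemma measurable_incr (s : ℝ) (k : Fin K) (i : Fin d) {t : ℕ} (ht : t ∈ Finset.Icc 1 T) :
    Measurable[r.hist t] (r.incr s k i t) := by
  unfold incr
  refine Finset.measurable_sum _ fun n _ => ?_
  refine Measurable.ite (r.hist.mono (Nat.sub_le t 1) _ (r.measurableSet_arm_eq n k ht)) ?_
    measurable_const
  have := (measurable_pi_apply i).comp (r.reward_meas n t ht)
  exact ((this.sub_const _).const_mul s).sub_const _

/-- The event that the agents play the joint action `a` in round `t`. -/
def joint (t : ℕ) (a : Fin N → Fin K) : Set Ω := {ω | ∀ n, r.arm n t ω = a n}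

lemma measurableSet_joint {t : ℕ} (ht : t ∈ Finset.Icc 1 T) (a : Fin N → Fin K) :
    MeasurableSet[r.hist (t - 1)] (r.joint t a) := by
  have : r.joint t a = ⋂ n, {ω | r.arm n t ω = a n} := by ext; simp [joint]
  rw [this]
  exact MeasurableSet.iInter fun n => r.measurableSet_arm_eq n _ ht

lemma iUnion_inter_joint (t : ℕ) (A : Set Ω) : ⋃ a, A ∩ r.joint t a = A := by
  ext ω
  simp only [Set.mem_iUnion, Set.mem_inter_iff, joint, Set.mem_ofPred_eq]
  exact ⟨fun ⟨_, h, _⟩ => h, fun h => ⟨fun n => r.arm n t ω, h, fun _ => rfl⟩⟩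

lemma pairwise_disjoint_joint (t : ℕ) (A : Set Ω) :
    Pairwise (Function.onFun Disjoint fun a => A ∩ r.joint t a) := by
  intro a b hab
  refine Set.disjoint_left.2 fun ω ha hb => hab ?_
  funext n
  rw [← ha.2 n, ← hb.2 n]

-- With the joint action frozen on `A`, the rewards have a product law there, so the integral
-- factorizes over the agents; each factor is 1 or is bounded by Hoeffding's lemma.
open ProbabilityTheory in
lemma setLIntegral_incr_le_of_joint (hD : ∀ k, IsProbabilityMeasure (D k))
    (hD1 : ∀ k, D k (Set.Icc (0 : Fin d → ℝ) 1)ᶜ = 0) (s : ℝ) (k : Fin K) (i : Fin d) {t : ℕ}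
    (ht : t ∈ Finset.Icc 1 T) {A : Set Ω} (hA : MeasurableSet[r.hist (t - 1)] A)
    (a : Fin N → Fin K) (ha : ∀ ω ∈ A, ∀ n, r.arm n t ω = a n) :
    ∫⁻ ω in A, ENNReal.ofReal (Real.exp (r.incr s k i t ω)) ∂P ≤ P A := by
  set F : Fin N → (Fin d → ℝ) → ENNReal := fun n x => ENNReal.ofReal (Real.exp
    (if a n = k then s * (x i - meanVec (D k) i) - s ^ 2 / 8 else 0)) with hF
  have hFm : ∀ n, Measurable (F n) := by
    intro n
    simp only [hF]
    split_ifs <;> fun_prop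
  have hGm : Measurable fun R : Fin N → Fin d → ℝ => ∏ n, F n (R n) :=
    Finset.measurable_prod _ fun n _ => (hFm n).comp (measurable_pi_apply n)
  have hR : Measurable fun ω n => r.reward n t ω :=
    measurable_pi_lambda _ fun n => r.measurable_reward n ht
  have h1 : ∫⁻ ω in A, ENNReal.ofReal (Real.exp (r.incr s k i t ω)) ∂P =
      ∫⁻ ω in A, ∏ n, F n (r.reward n t ω) ∂P := by
    refine setLIntegral_congr_fun (r.hist.le _ _ hA) fun ω hω => ?_
    simp only [incr, hF]
    rw [Real.exp_sum, ENNReal.ofReal_prod_of_nonneg fun _ _ => (Real.exp_pos _).le]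
    refine Finset.prod_congr rfl fun n _ => ?_
    rw [ha ω hω n]
  have h2 := lintegral_map (μ := P.restrict A) hGm hR
  rw [h1, ← h2, r.reward_law t ht a A hA ha, lintegral_smul_measure]
  have h3 : ∫⁻ R, ∏ n, F n (R n) ∂(Measure.pi fun n => D (a n)) =
      ∏ n, ∫⁻ x, F n x ∂(D (a n)) := by
    rw [lintegral_prod_eq_prod_lintegral_of_indepFun Finset.univ
      (fun n (R : Fin N → Fin d → ℝ) => F n (R n))
      (iIndepFun_pi fun n => (hFm n).aemeasurable)
      (fun n => (hFm n).comp (measurable_pi_apply n))]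
    refine Finset.prod_congr rfl fun n _ => ?_
    exact (measurePreserving_eval (fun n => D (a n)) n).lintegral_comp (hFm n)
  rw [h3, smul_eq_mul]
  refine mul_le_of_le_one_right' (Finset.prod_le_one' fun n _ => ?_)
  by_cases hk : a n = k
  · simp only [hF, hk, if_true]
    exact lintegral_exp_coord_le_one (D k) (hD1 k) i s
  · simp [hF, hk]

lemma setLIntegral_incr_le (hD : ∀ k, IsProbabilityMeasure (D k))
    (hD1 : ∀ k, D k (Set.Icc (0 : Fin d → ℝ) 1)ᶜ = 0) (s : ℝ) (k : Fin K) (i : Fin d) {t : ℕ}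
    (ht : t ∈ Finset.Icc 1 T) {A : Set Ω} (hA : MeasurableSet[r.hist (t - 1)] A) :
    ∫⁻ ω in A, ENNReal.ofReal (Real.exp (r.incr s k i t ω)) ∂P ≤ P A := by
  have hm : ∀ a, MeasurableSet[r.hist (t - 1)] (A ∩ r.joint t a) :=
    fun a => hA.inter (r.measurableSet_joint ht a)
  have hm' := fun a => r.hist.le _ _ (hm a)
  conv_lhs => rw [← r.iUnion_inter_joint t A]
  conv_rhs => rw [← r.iUnion_inter_joint t A]
  rw [lintegral_iUnion hm' (r.pairwise_disjoint_joint t A),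
    measure_iUnion (r.pairwise_disjoint_joint t A) hm']
  exact ENNReal.tsum_le_tsum fun a =>
    r.setLIntegral_incr_le_of_joint hD hD1 s k i ht (hm a) a fun ω hω => hω.2

lemma measure_reward_notMem_eq_zero (hD : ∀ k, IsProbabilityMeasure (D k))
    (hD1 : ∀ k, D k (Set.Icc (0 : Fin d → ℝ) 1)ᶜ = 0) (n : Fin N) {t : ℕ}
    (ht : t ∈ Finset.Icc 1 T) :
    P {ω | r.reward n t ω ∉ Set.Icc (0 : Fin d → ℝ) 1} = 0 := by
  rw [← r.iUnion_inter_joint t {ω | r.reward n t ω ∉ Set.Icc (0 : Fin d → ℝ) 1}]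
  refine measure_iUnion_null fun a => ?_
  have hS : MeasurableSet (Set.Icc (0 : Fin d → ℝ) 1)ᶜ := measurableSet_Icc.compl
  have hR : Measurable fun ω n => r.reward n t ω :=
    measurable_pi_lambda _ fun n => r.measurable_reward n ht
  have hev : MeasurableSet (Function.eval n ⁻¹' (Set.Icc (0 : Fin d → ℝ) 1)ᶜ :
      Set (Fin N → Fin d → ℝ)) := measurable_pi_apply n hS
  have h := congrArg (fun μ => μ (Function.eval n ⁻¹' (Set.Icc (0 : Fin d → ℝ) 1)ᶜ))
    (r.reward_law t ht a _ (r.measurableSet_joint ht a) fun ω hω => hω)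
  beta_reduce at h
  rw [Measure.map_apply hR hev, Measure.restrict_apply (hR hev), Measure.smul_apply,
    (measurePreserving_eval (fun n => D (a n)) n).measure_preimage hS.nullMeasurableSet, hD1,
    smul_zero] at h
  exact h

/-- The exponential supermartingale accumulated over the rounds in which the events `E` hold. -/
def accum (E : ℕ → Set Ω) (s : ℝ) (k : Fin K) (i : Fin d) (t : ℕ) (ω : Ω) : ℝ :=
  ∑ τ ∈ Finset.Icc 1 t, (E τ).indicator (r.incr s k i τ) ω

lemma measurable_accum {E : ℕ → Set Ω}
    (hE : ∀ t ∈ Finset.Icc 1 T, MeasurableSet[r.hist (t - 1)] (E t))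
    (s : ℝ) (k : Fin K) (i : Fin d) {t : ℕ} (ht : t ≤ T) :
    Measurable[r.hist t] (r.accum E s k i t) := by
  unfold accum
  refine Finset.measurable_sum _ fun τ hτ => ?_
  have hτ' := Finset.mem_Icc.1 hτ
  have hτT : τ ∈ Finset.Icc 1 T := Finset.mem_Icc.2 ⟨hτ'.1, hτ'.2.trans ht⟩
  refine Measurable.indicator ?_ (r.hist.mono (by omega) _ (hE τ hτT))
  exact (r.measurable_incr s k i hτT).mono (r.hist.mono hτ'.2) le_rfl

lemma lintegral_exp_accum_le_one [IsProbabilityMeasure P] (hD : ∀ k, IsProbabilityMeasure (D k))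
    (hD1 : ∀ k, D k (Set.Icc (0 : Fin d → ℝ) 1)ᶜ = 0) {E : ℕ → Set Ω}
    (hE : ∀ t ∈ Finset.Icc 1 T, MeasurableSet[r.hist (t - 1)] (E t))
    (s : ℝ) (k : Fin K) (i : Fin d) {t : ℕ} (ht : t ≤ T) :
    ∫⁻ ω, ENNReal.ofReal (Real.exp (r.accum E s k i t ω)) ∂P ≤ 1 := by
  induction t with
  | zero => simp [accum]
  | succ t ih =>
    refine le_trans ?_ (ih (by omega))
    have htT : t + 1 ∈ Finset.Icc 1 T := Finset.mem_Icc.2 ⟨by omega, ht⟩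
    have hEt := hE _ htT
    rw [Nat.add_sub_cancel] at hEt
    have hsplit : ∀ ω, ENNReal.ofReal (Real.exp (r.accum E s k i (t + 1) ω)) =
        ENNReal.ofReal (Real.exp (r.accum E s k i t ω)) *
        ENNReal.ofReal (Real.exp ((E (t + 1)).indicator (r.incr s k i (t + 1)) ω)) := by
      intro ω
      rw [← ENNReal.ofReal_mul (Real.exp_pos _).le, ← Real.exp_add, accum,
        Finset.sum_Icc_succ_top (by omega), accum]
    simp_rw [hsplit]
    refine lintegral_mul_le_of_setLIntegral_le (r.hist.le t) ?_ ?_ ?_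
    · exact ENNReal.measurable_ofReal.comp
        (Real.measurable_exp.comp (r.measurable_accum hE s k i (by omega)))
    · exact ENNReal.measurable_ofReal.comp (Real.measurable_exp.comp
        (((r.measurable_incr s k i htT).mono (r.hist.le _) le_rfl).indicator (r.hist.le _ _ hEt)))
    · intro A hA
      have hEm := r.hist.le _ _ hEt
      have hAm := r.hist.le _ _ hA
      -- On `E (t + 1)`, which is known at time `t`, the one-round bound applies; off it the factor
      -- is 1.
      rw [← lintegral_inter_add_sdiff _ A hEm, ← measure_inter_add_sdiff A hEm]
      refine add_le_add ?_ ?_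
      · rw [setLIntegral_congr_fun (g := fun ω =>
          ENNReal.ofReal (Real.exp (r.incr s k i (t + 1) ω))) (hAm.inter hEm)
          fun ω hω => by simp only [Set.indicator_of_mem hω.2]]
        exact r.setLIntegral_incr_le hD hD1 s k i htT
          (by rw [Nat.add_sub_cancel]; exact hA.inter hEt)
      · rw [setLIntegral_congr_fun (g := fun _ => 1) (hAm.diff hEm)
          fun ω hω => by simp [Set.indicator_of_notMem hω.2]]
        simp

end Run

/-! ### Concentration, uniformly in time. -/

namespace Run

variable {N K d T ν : ℕ} {Γ : ℝ} {D : Fin K → Measure (Fin d → ℝ)}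
  {Ω : Type*} [MeasurableSpace Ω] {P : Measure Ω} (r : Run N K d T ν Γ D P)

/-- The sum of the centred clean rewards of arm `k` in the rounds `1, …, t`, at coordinate `i`. -/
def cleanDev (k : Fin K) (i : Fin d) (t : ℕ) (ω : Ω) : ℝ :=
  ∑ τ ∈ Finset.Icc 1 t, ∑ n, if r.arm n τ ω = k then r.reward n τ ω i - meanVec (D k) i else 0

lemma sum_incr (s : ℝ) (k : Fin K) (i : Fin d) (t : ℕ) (ω : Ω) :
    ∑ τ ∈ Finset.Icc 1 t, r.incr s k i τ ω =
      s * r.cleanDev k i t ω - s ^ 2 / 8 * r.count k t ω := by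
  simp only [cleanDev, count, incr, Nat.cast_sum, Finset.mul_sum, ← Finset.sum_sub_distrib]
  refine Finset.sum_congr rfl fun τ _ => Finset.sum_congr rfl fun n _ => ?_
  split_ifs <;> simp

lemma incr_eq_zero_of_batch_eq_zero (s : ℝ) (k : Fin K) (i : Fin d) (t : ℕ) (ω : Ω)
    (h : r.batch k t ω = 0) : r.incr s k i t ω = 0 := by
  rw [batch, Finset.sum_eq_zero_iff] at h
  refine Finset.sum_eq_zero fun n hn => if_neg fun hk => ?_
  simpa [hk] using h n hn

/-- Up to `t` every round is included. A later round either keeps the count at `m`, hence has no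
pull of `k` and increment zero, or exceeds `m` and is excluded. -/
lemma accum_count_le_eq (s : ℝ) (k : Fin K) (i : Fin d) {m t t' : ℕ} (htt : t ≤ t') (ω : Ω)
    (hm : r.count k t ω = m) :
    r.accum (fun τ => {ω | r.count k τ ω ≤ m}) s k i t' ω =
      s * r.cleanDev k i t ω - s ^ 2 / 8 * m := by
  induction t', htt using Nat.le_induction with
  | base =>
    rw [← hm, ← sum_incr, accum]
    refine Finset.sum_congr rfl fun τ hτ => Set.indicator_of_mem ?_ _
    exact r.count_mono k ω (Finset.mem_Icc.1 hτ).2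
  | succ t' htt ih =>
    rw [accum, Finset.sum_Icc_succ_top (by omega), ← accum, ih, add_eq_left]
    by_cases h : r.count k (t' + 1) ω ≤ m
    · have h1 : m ≤ r.count k t' ω := hm ▸ r.count_mono k ω htt
      have h2 := r.count_succ k t' ω
      rw [Set.indicator_of_mem (by exact h)]
      exact r.incr_eq_zero_of_batch_eq_zero s k i _ ω (by omega)
    · exact Set.indicator_of_notMem (by exact h) _

lemma measure_exists_cleanDev_gt_le [IsProbabilityMeasure P] (hD : ∀ k, IsProbabilityMeasure (D k))
    (hD1 : ∀ k, D k (Set.Icc (0 : Fin d → ℝ) 1)ᶜ = 0) (k : Fin K) (i : Fin d) {m : ℕ} (hm : 0 < m)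
    {σ l : ℝ} (hσ : σ ^ 2 = 1) (hl : 0 ≤ l) :
    P {ω | ∃ t ≤ T, r.count k t ω = m ∧ √(m * (l / 2)) < σ * r.cleanDev k i t ω} ≤
      ENNReal.ofReal (Real.exp (-l)) := by
  have hm' : (0 : ℝ) < m := by exact_mod_cast hm
  set E : ℕ → Set Ω := fun τ => {ω | r.count k τ ω ≤ m} with hEdef
  have hE : ∀ t ∈ Finset.Icc 1 T, MeasurableSet[r.hist (t - 1)] (E t) := fun t ht =>
    (r.measurable_count k ht) measurableSet_Iic
  -- `s` maximizes `s * x - s ^ 2 / 8 * m` at the threshold `x = σ * √(m * (l / 2))`: the linear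
  -- term is `2 * l`, the quadratic one `l`, leaving exponent `l`.
  set q : ℝ := √(l / 2) / √m with hq
  set s : ℝ := 4 * q * σ with hs
  have hsm : s ^ 2 / 8 * m = l := by
    have h1 : q ^ 2 = l / 2 / m := by
      rw [hq, div_pow, Real.sq_sqrt (by positivity), Real.sq_sqrt hm'.le]
    calc s ^ 2 / 8 * m = 2 * q ^ 2 * σ ^ 2 * m := by rw [hs]; ring
      _ = l := by rw [h1, hσ]; field_simp
  have hint := r.lintegral_exp_accum_le_one hD hD1 hE s k i (le_refl T)
  have hmeas : Measurable fun ω => ENNReal.ofReal (Real.exp (r.accum E s k i T ω)) :=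
    ENNReal.measurable_ofReal.comp (Real.measurable_exp.comp
      ((r.measurable_accum hE s k i (le_refl T)).mono (r.hist.le T) le_rfl))
  have hmarkov := (mul_meas_ge_le_lintegral (μ := P) hmeas
    (ENNReal.ofReal (Real.exp l))).trans hint
  have hsub : {ω | ∃ t ≤ T, r.count k t ω = m ∧ √(m * (l / 2)) < σ * r.cleanDev k i t ω} ⊆
      {ω | ENNReal.ofReal (Real.exp l) ≤ ENNReal.ofReal (Real.exp (r.accum E s k i T ω))} := by
    rintro ω ⟨t, ht, hc, hdev⟩
    refine ENNReal.ofReal_le_ofReal (Real.exp_le_exp.2 ?_)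
    rw [r.accum_count_le_eq s k i ht ω hc, hsm]
    have h2 : q * √(m * (l / 2)) = l / 2 := by
      rw [Real.sqrt_mul hm'.le, hq]
      have h3 : √(m : ℝ) ≠ 0 := (Real.sqrt_pos.2 hm').ne'
      rw [div_mul_eq_mul_div, mul_left_comm, Real.mul_self_sqrt (by positivity)]
      field_simp
    have h3 : q * √(m * (l / 2)) ≤ q * (σ * r.cleanDev k i t ω) :=
      mul_le_mul_of_nonneg_left hdev.le (by positivity)
    have h4 : s * r.cleanDev k i t ω = 4 * (q * (σ * r.cleanDev k i t ω)) := by rw [hs]; ring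
    linarith
  refine (measure_mono hsub).trans ?_
  rw [Real.exp_neg, ENNReal.ofReal_inv_of_pos (Real.exp_pos l)]
  refine ENNReal.le_inv_iff_mul_le.2 ?_
  rw [mul_comm]
  exact hmarkov

/-- The rewards lie in the unit cube, and all clean empirical means concentrate at level `l`. -/
structure IsGood (l : ℝ) (ω : Ω) : Prop where
  mem : ∀ n, ∀ t ∈ Finset.Icc 1 T, r.reward n t ω ∈ Set.Icc (0 : Fin d → ℝ) 1
  dev : ∀ k i, ∀ t ≤ T, 0 < r.count k t ω →
    |r.cleanDev k i t ω| ≤ √(r.count k t ω * (l / 2))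

lemma measure_not_isGood_le [IsProbabilityMeasure P] (hD : ∀ k, IsProbabilityMeasure (D k))
    (hD1 : ∀ k, D k (Set.Icc (0 : Fin d → ℝ) 1)ᶜ = 0) {l : ℝ} (hl : 0 ≤ l) :
    P {ω | ¬ r.IsGood l ω} ≤ ENNReal.ofReal (2 * d * K * N * T * Real.exp (-l)) := by
  -- The third index is the count minus one, since only positive counts matter.
  set B : Fin K × Fin d × Fin (N * T) × Bool → Set Ω := fun x =>
    {ω | ∃ t ≤ T, r.count x.1 t ω = x.2.2.1 + 1 ∧ √((x.2.2.1 + 1 : ℕ) * (l / 2)) <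
      (if x.2.2.2 then 1 else -1) * r.cleanDev x.1 x.2.1 t ω} with hB
  set Z : Set Ω := ⋃ n, ⋃ t ∈ Finset.Icc 1 T,
    {ω | r.reward n t ω ∉ Set.Icc (0 : Fin d → ℝ) 1} with hZ
  have hZ0 : P Z = 0 := by
    refine measure_iUnion_null fun n => ?_
    exact (measure_biUnion_null_iff (Finset.countable_toSet _)).2 fun t ht =>
      r.measure_reward_notMem_eq_zero hD hD1 n ht
  have hsub : {ω | ¬ r.IsGood l ω} ⊆ Z ∪ ⋃ x, B x := by
    intro ω hω
    by_contra hcon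
    rw [Set.mem_union, not_or] at hcon
    obtain ⟨h1, h2⟩ := hcon
    refine hω ⟨fun n t ht => ?_, fun k i t ht hpos => ?_⟩
    · by_contra hmem
      exact h1 (Set.mem_iUnion.2 ⟨n, Set.mem_iUnion₂.2 ⟨t, ht, hmem⟩⟩)
    · by_contra hdev
      rw [not_le, lt_abs] at hdev
      have hcount : r.count k t ω ≤ N * T :=
        calc r.count k t ω ≤ ∑ k, r.count k t ω :=
              Finset.single_le_sum (f := fun k => r.count k t ω) (by simp) (Finset.mem_univ k)
          _ = N * t := r.sum_count t ω
          _ ≤ N * T := Nat.mul_le_mul_left N ht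
      have hsucc : r.count k t ω - 1 + 1 = r.count k t ω := by omega
      have key : ∀ b : Bool, √(r.count k t ω * (l / 2)) <
          (if b then 1 else -1) * r.cleanDev k i t ω → False := by
        intro b hb
        refine h2 (Set.mem_iUnion.2 ⟨(k, i, ⟨r.count k t ω - 1, by omega⟩, b), t, ht, ?_, ?_⟩)
        · exact hsucc.symm
        · simp only [hsucc]
          exact hb
      rcases hdev with h | h
      · exact key true (by simpa using h)
      · exact key false (by simpa using h)
  refine (measure_mono hsub).trans ((measure_union_le _ _).trans ?_)
  rw [hZ0, zero_add]
  have hBx : ∀ x, P (B x) ≤ ENNReal.ofReal (Real.exp (-l)) := fun x =>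
    r.measure_exists_cleanDev_gt_le hD hD1 x.1 x.2.1 (Nat.succ_pos _)
      (by split_ifs <;> norm_num) hl
  refine (measure_iUnion_fintype_le P B).trans ((Finset.sum_le_sum fun x _ => hBx x).trans ?_)
  rw [Finset.sum_const, ← ENNReal.ofReal_nsmul]
  refine ENNReal.ofReal_le_ofReal (le_of_eq ?_)
  simp
  ring

end Run

/-! ### The unit cube and scalarizations on it. -/

section Clip

variable {d : ℕ}

lemma clip_mem (x : Fin d → ℝ) : clip x ∈ Set.Icc (0 : Fin d → ℝ) 1 :=
  ⟨fun _ => le_max_left _ _, fun _ => max_le zero_le_one (min_le_left _ _)⟩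

lemma clip_eq_self {x : Fin d → ℝ} (hx : x ∈ Set.Icc (0 : Fin d → ℝ) 1) : clip x = x := by
  funext i
  have h0 : 0 ≤ x i := hx.1 i
  have h1 : x i ≤ 1 := hx.2 i
  rw [clip, min_eq_right h1, max_eq_right h0]

lemma clip_mono {x y : Fin d → ℝ} (h : x ≤ y) : clip x ≤ clip y :=
  fun i => max_le_max le_rfl (min_le_min le_rfl (h i))

lemma abs_clip_sub_le (x y : Fin d → ℝ) (i : Fin d) : |clip x i - clip y i| ≤ |x i - y i| := by
  refine (abs_max_sub_max_le_max _ _ _ _).trans (max_le (by simp) ?_)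
  exact (abs_min_sub_min_le_max _ _ _ _).trans (max_le (by simp) le_rfl)

lemma meanVec_mem {μ : Measure (Fin d → ℝ)} [IsProbabilityMeasure μ]
    (hμ : μ (Set.Icc (0 : Fin d → ℝ) 1)ᶜ = 0) : meanVec μ ∈ Set.Icc (0 : Fin d → ℝ) 1 := by
  have h : ∀ᵐ x ∂μ, x ∈ Set.Icc (0 : Fin d → ℝ) 1 := hμ
  have hb : ∀ i, ∀ᵐ x ∂μ, x i ∈ Set.Icc (0 : ℝ) 1 := fun i => by
    filter_upwards [h] with x hx using ⟨hx.1 i, hx.2 i⟩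
  have hint : ∀ i, Integrable (fun x : Fin d → ℝ => x i) μ := fun i =>
    Integrable.of_mem_Icc 0 1 (measurable_pi_apply i).aemeasurable (hb i)
  refine ⟨fun i => ?_, fun i => ?_⟩
  · exact integral_nonneg_of_ae ((hb i).mono fun x hx => hx.1)
  · have := integral_mono_ae (hint i) (integrable_const (1 : ℝ)) ((hb i).mono fun x hx => hx.2)
    simpa [meanVec] using this

end Clip

namespace IsScalarization

variable {d : ℕ} {L : ℝ} {φ : (Fin d → ℝ) → ℝ}

lemma sub_le (hφ : IsScalarization L φ) {x y : Fin d → ℝ}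
    (hx : x ∈ Set.Icc (0 : Fin d → ℝ) 1)
    (hy : y ∈ Set.Icc (0 : Fin d → ℝ) 1) (hL : 0 ≤ L) {ε : ℝ} (hε : 0 ≤ ε)
    (h : ∀ i, |x i - y i| ≤ ε) : φ x - φ y ≤ L * ε :=
  (le_abs_self _).trans ((hφ.lip x hx y hy).trans
    (mul_le_mul_of_nonneg_left ((pi_norm_le_iff_of_nonneg hε).2 h) hL))

lemma nonneg (hφ : IsScalarization L φ) (hd : 0 < d) : 0 ≤ L := by
  have : Nonempty (Fin d) := ⟨⟨0, hd⟩⟩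
  have h := (abs_nonneg _).trans
    (hφ.lip 1 ⟨zero_le_one, le_rfl⟩ 0 ⟨le_rfl, zero_le_one⟩)
  rwa [sub_zero, norm_one, mul_one] at h

lemma sub_le_of_mem (hφ : IsScalarization L φ) {x y : Fin d → ℝ}
    (hx : x ∈ Set.Icc (0 : Fin d → ℝ) 1)
    (hy : y ∈ Set.Icc (0 : Fin d → ℝ) 1) (hL : 0 ≤ L) : φ x - φ y ≤ L := by
  have h := hφ.sub_le hx hy hL zero_le_one fun i => by
    have h1 : 0 ≤ x i := hx.1 i
    have h2 : x i ≤ 1 := hx.2 i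
    have h3 : 0 ≤ y i := hy.1 i
    have h4 : y i ≤ 1 := hy.2 i
    rw [abs_le]
    constructor <;> linarith
  rwa [mul_one] at h

end IsScalarization

/-! ### Charging batches to a potential. -/

/-- The potential that pays for the pulls of an arm, in units of the Lipschitz constant. -/
def potential (N : ℕ) (A G : ℝ) (n : ℕ) : ℝ :=
  (min n (2 * N) : ℕ) + 6 * A * √n + 4 * G * Real.log (max 1 (n : ℝ))

/-- A batch of at most `N` pulls is paid for by the increase of the potential. -/
lemma batch_mul_le_potential_sub {N n b : ℕ} (hb : b ≤ N) {A G L Δ : ℝ} (hA : 0 ≤ A) (hG : 0 ≤ G)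
    (hL : 0 ≤ L) (hΔ : Δ ≤ L) (h : 0 < n → Δ ≤ L * (2 * (A / √n + G / n))) :
    b * Δ ≤ L * (potential N A G (n + b) - potential N A G n) := by
  have hsq : √(n : ℝ) ≤ √((n + b : ℕ) : ℝ) := Real.sqrt_le_sqrt (by push_cast; simp)
  have hlog : Real.log (max 1 (n : ℝ)) ≤ Real.log (max 1 ((n + b : ℕ) : ℝ)) :=
    Real.log_le_log (by positivity) (max_le_max le_rfl (by push_cast; simp))
  have hmin : ((min n (2 * N) : ℕ) : ℝ) ≤ (min (n + b) (2 * N) : ℕ) := by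
    exact_mod_cast min_le_min (Nat.le_add_right n b) le_rfl
  unfold potential
  -- From `n < N` a batch stays below `2 * N`, so the truncated linear term grows by exactly `b`.
  -- Otherwise `b ≤ n`, and the other two terms pay.
  by_cases hn : n < N
  · have h1 : min n (2 * N) = n := by omega
    have h2 : min (n + b) (2 * N) = n + b := by omega
    have h3 : (b : ℝ) * Δ ≤ L * b := by rw [mul_comm]; gcongr
    refine h3.trans (mul_le_mul_of_nonneg_left ?_ hL)
    rw [h1, h2, Nat.cast_add n b]
    have h4 : 6 * A * √(n : ℝ) ≤ 6 * A * √((n + b : ℕ) : ℝ) := by gcongr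
    have h5 : 4 * G * Real.log (max 1 (n : ℝ)) ≤ 4 * G * Real.log (max 1 ((n + b : ℕ) : ℝ)) := by
      gcongr
    rw [Nat.cast_add n b] at h4 h5
    linarith
  · rcases Nat.eq_zero_or_pos b with rfl | hbpos
    · simp
    have hnpos : 0 < n := by omega
    have hn' : (0 : ℝ) < n := by exact_mod_cast hnpos
    have hn1 : (1 : ℝ) ≤ n := by exact_mod_cast hnpos
    have hbn : (b : ℝ) ≤ n := by exact_mod_cast (by omega : b ≤ n)
    have hb0 : (0 : ℝ) ≤ b := by positivity
    have hsn : 0 < √(n : ℝ) := Real.sqrt_pos.2 hn'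
    -- `b` is the difference of the two roots times their sum, and the sum is at most `3 * √n`.
    have hroot : b / √(n : ℝ) ≤ 3 * (√((n + b : ℕ) : ℝ) - √(n : ℝ)) := by
      rw [div_le_iff₀ hsn]
      push_cast
      have e1 := Real.sq_sqrt hn'.le
      have e2 := Real.sq_sqrt (by positivity : (0 : ℝ) ≤ n + b)
      have h2 : √((n : ℝ) + b) ≤ 2 * √(n : ℝ) := by
        rw [Real.sqrt_le_left (by positivity)]
        nlinarith
      push_cast at hsq
      nlinarith
    have hlg : b / (n : ℝ) ≤
        2 * (Real.log (max 1 ((n + b : ℕ) : ℝ)) - Real.log (max 1 (n : ℝ))) := by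
      rw [max_eq_right hn1, max_eq_right (by push_cast; linarith)]
      push_cast
      -- This gives `b / (n + b) ≤ log (n + b) - log n`; since `b ≤ n`, replacing `n + b` by `n`
      -- costs a factor 2.
      have h1 := Real.log_le_sub_one_of_pos (x := (n : ℝ) / (n + b)) (by positivity)
      rw [Real.log_div hn'.ne' (by positivity)] at h1
      have h2 : (n : ℝ) / (n + b) - 1 = -(b / (n + b)) := by field_simp; ring
      have h3 : b / (n : ℝ) ≤ 2 * (b / (n + b)) := by
        rw [← mul_div_assoc, div_le_div_iff₀ hn' (by positivity)]
        nlinarith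
      linarith
    calc b * Δ ≤ b * (L * (2 * (A / √n + G / n))) := by gcongr; exact h hnpos
      _ = L * (2 * A * (b / √n) + 2 * G * (b / n)) := by ring
      _ ≤ L * (2 * A * (3 * (√((n + b : ℕ) : ℝ) - √(n : ℝ))) + 2 * G *
          (2 * (Real.log (max 1 ((n + b : ℕ) : ℝ)) - Real.log (max 1 (n : ℝ))))) := by gcongr
      _ ≤ _ := mul_le_mul_of_nonneg_left (by linarith) hL

/-! ### Optimism and the regret bound. -/

namespace Run

variable {N K d T ν : ℕ} {Γ : ℝ} {D : Fin K → Measure (Fin d → ℝ)}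
  {Ω : Type*} [MeasurableSpace Ω] {P : Measure Ω} (r : Run N K d T ν Γ D P)

lemma abs_obs_sub_reward_le {n : Fin N} {t : ℕ} {ω : Ω}
    (h : r.reward n t ω ∈ Set.Icc (0 : Fin d → ℝ) 1) (i : Fin d) :
    |r.obs n t ω i - r.reward n t ω i| ≤ ‖r.corr n t ω‖ := by
  unfold obs
  split_ifs
  · simp
  · have h1 := abs_clip_sub_le (r.reward n t ω + r.corr n t ω) (r.reward n t ω) i
    rw [clip_eq_self h, Pi.add_apply, add_sub_cancel_left] at h1
    exact h1.trans (norm_le_pi_norm (r.corr n t ω) i)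

lemma sum_obs_sub_le {l : ℝ} {ω : Ω} (hω : r.IsGood l ω) (k : Fin K) (i : Fin d) {t : ℕ}
    (ht : t ≤ T) :
    |(∑ τ ∈ Finset.Icc 1 t, ∑ n, if r.arm n τ ω = k then r.obs n τ ω i else 0)
      - r.count k t ω * meanVec (D k) i - r.cleanDev k i t ω| ≤ r.armCorr k ω := by
  have h1 : (∑ τ ∈ Finset.Icc 1 t, ∑ n, if r.arm n τ ω = k then r.obs n τ ω i else 0)
      - r.count k t ω * meanVec (D k) i - r.cleanDev k i t ω =
      ∑ τ ∈ Finset.Icc 1 t, ∑ n,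
        if r.arm n τ ω = k then r.obs n τ ω i - r.reward n τ ω i else 0 := by
    simp only [cleanDev, count, Nat.cast_sum, Finset.sum_mul, ← Finset.sum_sub_distrib]
    refine Finset.sum_congr rfl fun τ _ => Finset.sum_congr rfl fun n _ => ?_
    split_ifs <;> simp
  have hsub : Finset.Icc 1 t ⊆ Finset.Icc 1 T := Finset.Icc_subset_Icc le_rfl ht
  rw [h1]
  calc _ ≤ ∑ τ ∈ Finset.Icc 1 t, ∑ n, if r.arm n τ ω = k then ‖r.corr n τ ω‖ else 0 := by
        refine (Finset.abs_sum_le_sum_abs _ _).trans (Finset.sum_le_sum fun τ hτ => ?_)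
        refine (Finset.abs_sum_le_sum_abs _ _).trans (Finset.sum_le_sum fun n _ => ?_)
        split_ifs
        · exact r.abs_obs_sub_reward_le (hω.mem n τ (hsub hτ)) i
        · simp
    _ ≤ r.armCorr k ω :=
        Finset.sum_le_sum_of_subset_of_nonneg hsub fun _ _ _ =>
          Finset.sum_nonneg fun _ _ => by split_ifs <;> simp

lemma radius_nonneg (δ : ℝ) (j : Fin N) (k : Fin K) (t : ℕ) (ω : Ω) : 0 ≤ r.radius δ j k t ω := by
  have := r.armCorr_nonneg k ω
  rw [radius, effCorrArm_eq]
  positivity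

lemma radius_eq (δ : ℝ) (j : Fin N) (k : Fin K) {t : ℕ} {ω : Ω} (h : 0 < r.count k t ω) :
    r.radius δ j k t ω = √(Real.log (2 * d * K * N * T / δ) / 2) / √(r.count k t ω)
      + r.effCorrArm k ω / r.count k t ω := by
  have h1 : (1 : ℝ) ≤ r.count k t ω := by exact_mod_cast h
  rw [radius, card_samples, max_eq_right h1, ← Real.sqrt_div' _ (by positivity), div_div]

lemma abs_estimate_sub_le {δ : ℝ} {ω : Ω}
    (hω : r.IsGood (Real.log (2 * d * K * N * T / δ)) ω) (j : Fin N) (k : Fin K) (i : Fin d)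
    {t : ℕ} (ht : t ≤ T) (h : 0 < r.count k t ω) :
    |r.estimate j k t ω i - meanVec (D k) i| ≤ r.radius δ j k t ω := by
  have h1 : (1 : ℝ) ≤ r.count k t ω := by exact_mod_cast h
  have h0 : (0 : ℝ) < r.count k t ω := by linarith
  have hN : (1 : ℝ) ≤ N := by exact_mod_cast Fin.pos j
  have hdev := hω.dev k i t ht h
  have hobs := r.sum_obs_sub_le hω k i ht
  rw [r.radius_eq δ j k h, estimate_apply, max_eq_right h1, effCorrArm_eq]
  set S := ∑ τ ∈ Finset.Icc 1 t, ∑ n, if r.arm n τ ω = k then r.obs n τ ω i else 0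
  set l := Real.log (2 * d * K * N * T / δ)
  have e1 : (r.count k t ω : ℝ)⁻¹ * S - meanVec (D k) i =
      (S - r.count k t ω * meanVec (D k) i) / r.count k t ω := by field_simp
  have e2 : √(l / 2) / √(r.count k t ω) = √(r.count k t ω * (l / 2)) / r.count k t ω := by
    rw [Real.sqrt_mul h0.le]
    have h3 : √(r.count k t ω : ℝ) ≠ 0 := (Real.sqrt_pos.2 h0).ne'
    rw [div_eq_div_iff h3 h0.ne', mul_right_comm, Real.mul_self_sqrt h0.le, mul_comm]
  rw [e1, e2, abs_div, abs_of_pos h0, ← add_div]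
  gcongr
  -- Corruption shifts the pooled sum by at most `armCorr`; the radius allows `N` times as much,
  -- which is where the `N * Γ` of the bound originates.
  have h4 : r.armCorr k ω ≤ N * r.armCorr k ω :=
    le_mul_of_one_le_left (r.armCorr_nonneg k ω) hN
  have h5 := abs_add_le (S - r.count k t ω * meanVec (D k) i - r.cleanDev k i t ω)
    (r.cleanDev k i t ω)
  rw [sub_add_cancel] at h5
  linarith

lemma le_index {L δ : ℝ} {φ : (Fin d → ℝ) → ℝ} (hφ : IsScalarization L φ)
    (hD : ∀ k, IsProbabilityMeasure (D k)) (hD1 : ∀ k, D k (Set.Icc (0 : Fin d → ℝ) 1)ᶜ = 0)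
    (hl : 2 ≤ Real.log (2 * d * K * N * T / δ)) {ω : Ω}
    (hω : r.IsGood (Real.log (2 * d * K * N * T / δ)) ω) (j : Fin N) (k : Fin K) {t : ℕ}
    (ht : t ≤ T) : φ (meanVec (D k)) ≤ r.index φ δ j k t ω := by
  have hmem := meanVec_mem (hD1 k)
  refine hφ.mono _ hmem _ (clip_mem _) ?_
  rw [← clip_eq_self hmem]
  refine clip_mono fun i => ?_
  rcases Nat.eq_zero_or_pos (r.count k t ω) with h | h
  · have h1 : meanVec (D k) i ≤ 1 := hmem.2 i
    have h2 : r.estimate j k t ω i = 0 := by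
      have hsum : ∀ τ ∈ Finset.Icc 1 t, ∀ n ∈ Finset.univ, r.arm n τ ω ≠ k := by
        intro τ hτ n hn hk
        rw [count, Finset.sum_eq_zero_iff] at h
        simpa [hk] using Finset.sum_eq_zero_iff.1 (h τ hτ) n hn
      rw [estimate_apply, Finset.sum_eq_zero fun τ hτ => Finset.sum_eq_zero fun n hn =>
        if_neg (hsum τ hτ n hn), mul_zero]
    -- An unsampled arm has estimate 0, so its optimism requires radius at least 1; hence the
    -- assumption `2 ≤ l`.
    have h3 : 1 ≤ r.radius δ j k t ω := by
      have := r.armCorr_nonneg k ω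
      have h4 : 1 ≤ √(Real.log (2 * d * K * N * T / δ) / 2) := Real.one_le_sqrt.2 (by linarith)
      have h5 : 0 ≤ N * r.armCorr k ω := by positivity
      simp only [radius, card_samples, h, effCorrArm_eq, Nat.cast_zero, max_eq_left zero_le_one,
        mul_one, div_one]
      linarith
    linarith
  · have := abs_le.1 (r.abs_estimate_sub_le hω j k i ht h)
    linarith [this.1]

lemma index_le {L δ : ℝ} {φ : (Fin d → ℝ) → ℝ} (hφ : IsScalarization L φ) (hL : 0 ≤ L)
    (hD : ∀ k, IsProbabilityMeasure (D k)) (hD1 : ∀ k, D k (Set.Icc (0 : Fin d → ℝ) 1)ᶜ = 0)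
    {ω : Ω} (hω : r.IsGood (Real.log (2 * d * K * N * T / δ)) ω) (j : Fin N) (k : Fin K) {t : ℕ}
    (ht : t ≤ T) (h : 0 < r.count k t ω) :
    r.index φ δ j k t ω - φ (meanVec (D k)) ≤ L * (2 * r.radius δ j k t ω) := by
  have hmem := meanVec_mem (hD1 k)
  have hr := r.radius_nonneg δ j k t ω
  refine hφ.sub_le (clip_mem _) hmem hL (by positivity) fun i => ?_
  rw [← clip_eq_self hmem]
  refine (abs_clip_sub_le _ _ i).trans ?_
  have h1 := r.abs_estimate_sub_le hω j k i ht h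
  rw [add_sub_right_comm]
  refine (abs_add_le _ _).trans ?_
  rw [abs_of_nonneg hr]
  linarith

lemma teamRegret_eq (φ : (Fin d → ℝ) → ℝ) (kstar : Fin K) (ω : Ω) :
    r.teamRegret φ kstar ω = ∑ k, ∑ t ∈ Finset.Icc 1 T,
      r.batch k t ω * (φ (meanVec (D kstar)) - φ (meanVec (D k))) := by
  rw [Finset.sum_comm, teamRegret]
  refine Finset.sum_congr rfl fun t _ => ?_
  simp only [batch, Nat.cast_sum, Finset.sum_mul]
  rw [Finset.sum_comm]
  refine Finset.sum_congr rfl fun n _ => ?_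
  simp

/-- The potential telescopes over rounds. One agent pulling `k` in a round suffices to bound the
gap, and the bound then serves the whole batch. -/
lemma sum_batch_mul_le {L δ : ℝ} {φ : (Fin d → ℝ) → ℝ} (hφ : IsScalarization L φ) (hL : 0 ≤ L)
    (hD : ∀ k, IsProbabilityMeasure (D k)) (hD1 : ∀ k, D k (Set.Icc (0 : Fin d → ℝ) 1)ᶜ = 0)
    (hl : 2 ≤ Real.log (2 * d * K * N * T / δ)) (hucb : r.IsAppendAllUCB φ δ) (kstar : Fin K)
    {ω : Ω} (hω : r.IsGood (Real.log (2 * d * K * N * T / δ)) ω) (k : Fin K) {t : ℕ}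
    (ht : t ≤ T) :
    ∑ τ ∈ Finset.Icc 1 t, r.batch k τ ω * (φ (meanVec (D kstar)) - φ (meanVec (D k))) ≤
      L * potential N √(Real.log (2 * d * K * N * T / δ) / 2) (r.effCorrArm k ω)
        (r.count k t ω) := by
  induction t with
  | zero => simp [count_zero, potential]
  | succ t ih =>
    have hG : 0 ≤ r.effCorrArm k ω := by
      have := r.armCorr_nonneg k ω
      rw [effCorrArm_eq]
      positivity
    rw [Finset.sum_Icc_succ_top (by omega), count_succ]
    have ih' := ih (by omega)
    suffices hstep : r.batch k (t + 1) ω * (φ (meanVec (D kstar)) - φ (meanVec (D k))) ≤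
        L * (potential N √(Real.log (2 * d * K * N * T / δ) / 2) (r.effCorrArm k ω)
          (r.count k t ω + r.batch k (t + 1) ω) -
        potential N √(Real.log (2 * d * K * N * T / δ) / 2) (r.effCorrArm k ω)
          (r.count k t ω)) by linarith
    by_cases hex : ∃ n, r.arm n (t + 1) ω = k
    · obtain ⟨n, hn⟩ := hex
      refine batch_mul_le_potential_sub (r.batch_le k _ ω) (by positivity) hG hL
        (hφ.sub_le_of_mem (meanVec_mem (hD1 kstar)) (meanVec_mem (hD1 k)) hL) fun hpos => ?_
      have h1 := r.le_index hφ hD hD1 hl hω n kstar (t := t) (by omega)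
      have h2 := r.index_le hφ hL hD hD1 hω n k (t := t) (by omega) hpos
      have h3 := hucb n (t + 1) (Finset.mem_Icc.2 ⟨by omega, ht⟩) ω kstar
      rw [hn, Nat.add_sub_cancel] at h3
      rw [← r.radius_eq δ n k hpos]
      linarith
    · have h0 : r.batch k (t + 1) ω = 0 :=
        Finset.sum_eq_zero fun n _ => if_neg fun h => hex ⟨n, h⟩
      simp [h0]

lemma sum_sqrt_count_le (t : ℕ) (ω : Ω) : ∑ k, √(r.count k t ω : ℝ) ≤ √(K * N * t) := by
  refine Real.le_sqrt_of_sq_le ?_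
  have h1 := sq_sum_le_card_mul_sum_sq (s := Finset.univ) (f := fun k => √(r.count k t ω : ℝ))
  simp only [Real.sq_sqrt (Nat.cast_nonneg _), Finset.card_univ, Fintype.card_fin] at h1
  have h2 : ∑ k, (r.count k t ω : ℝ) = N * t := by exact_mod_cast r.sum_count t ω
  rw [h2] at h1
  linarith

lemma teamRegret_le_of_isGood (hNK : N * K ≤ T) {L δ : ℝ} {φ : (Fin d → ℝ) → ℝ}
    (hφ : IsScalarization L φ) (hL : 0 ≤ L)
    (hD : ∀ k, IsProbabilityMeasure (D k)) (hD1 : ∀ k, D k (Set.Icc (0 : Fin d → ℝ) 1)ᶜ = 0)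
    (hl : 2 ≤ Real.log (2 * d * K * N * T / δ)) (hucb : r.IsAppendAllUCB φ δ) (kstar : Fin K)
    {ω : Ω} (hω : r.IsGood (Real.log (2 * d * K * N * T / δ)) ω) :
    r.teamRegret φ kstar ω ≤ 8 * L * (√(K * N * T * Real.log (2 * d * K * N * T / δ))
      + N * Γ * Real.log (1 + N * T)) := by
  have hk := fun k => r.sum_batch_mul_le hφ hL hD hD1 hl hucb kstar hω k le_rfl
  rw [teamRegret_eq]
  set l := Real.log (2 * d * K * N * T / δ) with hldef
  refine (Finset.sum_le_sum fun k _ => hk k).trans ?_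
  rw [← Finset.mul_sum, mul_comm (8 : ℝ) L, mul_assoc]
  refine mul_le_mul_of_nonneg_left ?_ hL
  simp only [potential, Finset.sum_add_distrib]
  have h1 : ∑ k, ((min (r.count k T ω) (2 * N) : ℕ) : ℝ) ≤ 2 * √(K * N * T * l) := by
    have h2 : ∑ k, ((min (r.count k T ω) (2 * N) : ℕ) : ℝ) ≤ 2 * (N * K) := by
      calc _ ≤ ∑ _k : Fin K, (2 * N : ℝ) :=
            Finset.sum_le_sum fun k _ => by exact_mod_cast min_le_right _ _
        _ = 2 * (N * K) := by simp; ring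
    -- The burn-in cost is absorbed because `N * K ≤ T` and `l ≥ 1`.
    have h3 : (N * K : ℝ) ≤ √(K * N * T * l) := by
      refine Real.le_sqrt_of_sq_le ?_
      have h4 : (N * K : ℝ) ≤ T := by exact_mod_cast hNK
      calc (N * K : ℝ) ^ 2 = (N * K) * (N * K) := by ring
        _ ≤ (N * K) * T := by gcongr
        _ = K * N * T * 1 := by ring
        _ ≤ K * N * T * l := by gcongr; linarith
    linarith
  have h2 : ∑ k, 6 * √(l / 2) * √(r.count k T ω : ℝ) ≤ 6 * √(K * N * T * l) := by
    rw [← Finset.mul_sum]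
    calc _ ≤ 6 * √(l / 2) * √(K * N * T) := by gcongr; exact r.sum_sqrt_count_le T ω
      _ ≤ 6 * √l * √(K * N * T) := by gcongr; linarith
      _ = 6 * √(K * N * T * l) := by rw [Real.sqrt_mul (by positivity) l]; ring
  have h3 : ∑ k, 4 * r.effCorrArm k ω * Real.log (max 1 (r.count k T ω : ℝ)) ≤
      4 * (N * Γ * Real.log (1 + N * T)) := by
    have hlog0 : 0 ≤ Real.log (1 + N * T) := Real.log_nonneg (by simp; positivity)
    calc _ ≤ ∑ k, 4 * (N * r.armCorr k ω) * Real.log (1 + N * T) := by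
          refine Finset.sum_le_sum fun k _ => ?_
          rw [effCorrArm_eq]
          have h4 : (r.count k T ω : ℝ) ≤ N * T := by
            have : r.count k T ω ≤ N * T := (r.sum_count T ω) ▸
              Finset.single_le_sum (f := fun k => r.count k T ω) (by simp) (Finset.mem_univ k)
            exact_mod_cast this
          have := r.armCorr_nonneg k ω
          gcongr
          refine max_le ?_ ?_ <;> linarith [Nat.cast_nonneg (α := ℝ) (r.count k T ω)]
      _ = 4 * (N * r.totalCorr ω * Real.log (1 + N * T)) := by
          rw [← sum_armCorr, Finset.mul_sum, Finset.sum_mul, Finset.mul_sum]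
          exact Finset.sum_congr rfl fun k _ => by ring
      _ ≤ _ := by gcongr; exact r.corr_budget ω
  have h4 : 0 ≤ N * Γ * Real.log (1 + N * T) := by
    have hΓ : 0 ≤ Γ := le_trans
      (Finset.sum_nonneg fun _ _ => Finset.sum_nonneg fun _ _ => norm_nonneg _) (r.corr_budget ω)
    have hlog0 : 0 ≤ Real.log (1 + N * T) := Real.log_nonneg (by simp; positivity)
    positivity
  linarith

/-- A small logarithm forces `2 * N * T < exp 2 < 9`, so the trivial regret bound `L * N * T`
suffices for every outcome. -/
lemma teamRegret_le_of_log_lt_two (hN : 0 < N) (hK : 0 < K) (hd : 0 < d) (hT : 0 < T) {L δ : ℝ}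
    (hδ0 : 0 < δ) (hδ1 : δ < 1) {φ : (Fin d → ℝ) → ℝ} (hφ : IsScalarization L φ) (hL : 0 ≤ L)
    (hD : ∀ k, IsProbabilityMeasure (D k)) (hD1 : ∀ k, D k (Set.Icc (0 : Fin d → ℝ) 1)ᶜ = 0)
    (hl : Real.log (2 * d * K * N * T / δ) < 2) (kstar : Fin K) (ω : Ω) :
    r.teamRegret φ kstar ω ≤ 8 * L * (√(K * N * T * Real.log (2 * d * K * N * T / δ))
      + N * Γ * Real.log (1 + N * T)) := by
  have hN' : (1 : ℝ) ≤ N := by exact_mod_cast hN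
  have hK' : (1 : ℝ) ≤ K := by exact_mod_cast hK
  have hd' : (1 : ℝ) ≤ d := by exact_mod_cast hd
  have hT' : (1 : ℝ) ≤ T := by exact_mod_cast hT
  have hreg : r.teamRegret φ kstar ω ≤ L * (N * T) := by
    calc r.teamRegret φ kstar ω ≤ ∑ _t ∈ Finset.Icc 1 T, ∑ _n : Fin N, L :=
          Finset.sum_le_sum fun t _ => Finset.sum_le_sum fun n _ =>
            hφ.sub_le_of_mem (meanVec_mem (hD1 kstar)) (meanVec_mem (hD1 _)) hL
      _ = L * (N * T) := by simp; ring
  have hpos : (0 : ℝ) < 2 * d * K * N * T / δ := by positivity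
  have hNT : (1 : ℝ) ≤ N * T := one_le_mul_of_one_le_of_one_le hN' hT'
  have hdK : (1 : ℝ) ≤ d * K := one_le_mul_of_one_le_of_one_le hd' hK'
  have hge : 2 * (N * T : ℝ) ≤ 2 * d * K * N * T / δ := by
    rw [le_div_iff₀ hδ0]
    calc 2 * (N * T : ℝ) * δ ≤ 2 * (N * T) * 1 := by gcongr
      _ = 1 * (2 * (N * T)) := by ring
      _ ≤ (d * K) * (2 * (N * T)) := by gcongr
      _ = 2 * d * K * N * T := by ring
  have hlt : 2 * d * K * N * T / δ < 9 := by
    have h1 := (Real.log_lt_iff_lt_exp hpos).1 hl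
    have h2 : Real.exp 2 = Real.exp 1 * Real.exp 1 := by rw [← Real.exp_add]; norm_num
    have h3 := Real.exp_one_lt_d9
    have h4 := Real.exp_pos 1
    nlinarith
  have hlog : 1 / 2 ≤ Real.log (2 * d * K * N * T / δ) := by
    have h1 : Real.log 2 ≤ Real.log (2 * d * K * N * T / δ) :=
      Real.log_le_log (by norm_num) (by linarith)
    linarith [Real.log_two_gt_d9]
  set l := Real.log (2 * d * K * N * T / δ) with hldef
  have h1 : (N * T : ℝ) ≤ 8 * √(K * N * T * l) := by
    have h2 : (N * T : ℝ) / 8 ≤ √(K * N * T * l) := by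
      refine Real.le_sqrt_of_sq_le ?_
      calc ((N * T : ℝ) / 8) ^ 2 ≤ 1 * (N * T) * (1 / 2) := by nlinarith
        _ ≤ K * (N * T) * l := by gcongr
        _ = K * N * T * l := by ring
    linarith
  have h4 : 0 ≤ N * Γ * Real.log (1 + N * T) := by
    have hΓ : 0 ≤ Γ := le_trans
      (Finset.sum_nonneg fun _ _ => Finset.sum_nonneg fun _ _ => norm_nonneg _) (r.corr_budget ω)
    have hlog0 : 0 ≤ Real.log (1 + N * T) := Real.log_nonneg (by simp; positivity)
    positivity
  refine hreg.trans ?_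
  rw [mul_comm (8 : ℝ) L, mul_assoc]
  exact mul_le_mul_of_nonneg_left (by linarith) hL

end Run

end CoopBandit

end

theorem corollary1 :
    ∃ c : ℝ, 0 < c ∧
      ∀ (N K d T ν : ℕ), 0 < N → 0 < K → 0 < d → N * K ≤ T →
      ∀ (Γ L δ : ℝ), 0 < δ → δ < 1 →
      ∀ (D : Fin K → Measure (Fin d → ℝ)), (∀ k, IsProbabilityMeasure (D k)) →
        (∀ k, D k (Set.Icc (0 : Fin d → ℝ) 1)ᶜ = 0) →
      ∀ (φ : (Fin d → ℝ) → ℝ), CoopBandit.IsScalarization L φ →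
      ∀ (kstar : Fin K),
        (∀ k, φ (CoopBandit.meanVec (D k)) ≤ φ (CoopBandit.meanVec (D kstar))) →
      ∀ {Ω : Type*} [MeasurableSpace Ω] (P : Measure Ω) [IsProbabilityMeasure P]
        (r : CoopBandit.Run N K d T ν Γ D P), r.IsAppendAllUCB φ δ →
        (∀ ω, (∀ n, ∀ t ∈ Finset.Icc 1 T, r.multiplicity n t ω = N) ∧
          r.effCorr ω = N * r.totalCorr ω ∧
          r.effCorr ω ≤ N * Γ ∧
          (r.totalCorr ω = Γ → r.effCorr ω = N * Γ)) ∧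
        1 - δ ≤ P.real {ω | r.teamRegret φ kstar ω ≤
          c * L * (√(K * N * T * Real.log (2 * d * K * N * T / δ))
            + N * Γ * Real.log (1 + N * T))} := by
  refine ⟨8, by norm_num, ?_⟩
  intro N K d T ν hN hK hd hNK Γ L δ hδ0 hδ1 D hD hD1 φ hφ kstar _ Ω _ P _ r hucb
  have hL := hφ.nonneg hd
  have hT : 0 < T := (Nat.mul_pos hN hK).trans_le hNK
  refine ⟨fun ω => ⟨fun n t ht => r.multiplicity_eq n ht ω, r.effCorr_eq ω, ?_, ?_⟩, ?_⟩
  · rw [r.effCorr_eq]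
    exact mul_le_mul_of_nonneg_left (r.corr_budget ω) (Nat.cast_nonneg N)
  · intro h
    rw [r.effCorr_eq, h]
  set G := {ω | r.teamRegret φ kstar ω ≤
    8 * L * (√(K * N * T * Real.log (2 * d * K * N * T / δ)) + N * Γ * Real.log (1 + N * T))}
  rcases lt_or_ge (Real.log (2 * d * K * N * T / δ)) 2 with hl | hl
  · have hG : G = Set.univ := Set.eq_univ_of_forall fun ω =>
      r.teamRegret_le_of_log_lt_two hN hK hd hT hδ0 hδ1 hφ hL hD hD1 hl kstar ω
    rw [hG, probReal_univ]
    linarith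
  · have hpos : (0 : ℝ) < 2 * d * K * N * T := by positivity
    have hbad := r.measure_not_isGood_le hD hD1 (zero_le_two.trans hl)
    rw [Real.exp_neg, Real.exp_log (by positivity), inv_div, mul_div_cancel₀ _ hpos.ne'] at hbad
    -- Covering and subadditivity avoid any measurability claim about `G`.
    have hcover : Set.univ ⊆ G ∪ {ω | ¬ r.IsGood (Real.log (2 * d * K * N * T / δ)) ω} := by
      intro ω _
      by_cases hω : r.IsGood (Real.log (2 * d * K * N * T / δ)) ω
      · exact Or.inl (r.teamRegret_le_of_isGood hNK hφ hL hD hD1 hl hucb kstar hω)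
      · exact Or.inr hω
    have h1 := measureReal_mono (μ := P) hcover
    have h2 := measureReal_union_le (μ := P) G
      {ω | ¬ r.IsGood (Real.log (2 * d * K * N * T / δ)) ω}
    have h3 := ENNReal.toReal_mono ENNReal.ofReal_ne_top hbad
    rw [ENNReal.toReal_ofReal hδ0.le] at h3
    rw [probReal_univ] at h1
    rw [Measure.real] at h2
    simp only [Measure.real] at h1 h2 ⊢
    linarith
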